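/- Let $\mathfrak H$ be a real or complex Hilbert space with norm $|\cdot|_2$ and real scalar product $\langle\cdot,\cdot\rangle_{\mathrm{real}}=\operatorname{Re}\langle\cdot,\cdot\rangle$, and let $\|\cdot\|_2$ be the operator norm. For $\mathbf x,\mathbf y\in\mathfrak H$, $\mathbf x\neq0$, put $$\mathbf y:\mathbf x=\frac{\langle\mathbf y,\mathbf x\rangle_{\mathrm{real}}}{|\mathbf x|_2^2}+\mathrm i\left|\frac{\mathbf y}{|\mathbf x|_2}-\frac{\langle\mathbf y,\mathbf x\rangle_{\mathrm{real}}}{|\mathbf x|_2^2}\frac{\mathbf x}{|\mathbf x|_2}\right|_2 ,$$ and for a bounded linear operator $A$ on $\mathfrak H$ let its conformal range be $$\mathrm{CR}(A)=\{A\mathbf x:\mathbf x,\ \overline{(A\mathbf x:\mathbf x)}\ ;\ \mathbf x\in\mathfrak H\setminus\{0\}\}\subset\mathbb C .$$ The logarithm of $A$ is well-defined if $(1-t)\mathrm{Id}+tA$ is invertible for all $t\in[0,1]$, and then $\log A=\int_0^1 (A-\mathrm{Id})\,((1-t)\mathrm{Id}+tA)^{-1}\,\mathrm dt$. Let $\overline{\mathrm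 D}(0,p)=\{z\in\mathbb C: |z|\le p\}$. Theorem. Let $0<p<\pi$. If $\mathrm{CR}(A)\subset\exp\overline{\mathrm D}(0,p)$, then $\log A$ is well-defined and $$\|\log A\|_2\le H(p),$$ where $$H(p)=p-2\log\left(2\cosh\frac p2-\frac2p\sinh\frac p2\right)+\int_0^\pi HH(p,t)\,\mathrm dt$$ with $$HH(p,t)=\frac{(\sin(p\sin t)-(p\sin t)\cos(p\sin t))\,(\mathrm e^{p\cos t}+\mathrm e^{-p\cos t}-2\cos(p\sin t))}{\sin(p\sin t)\,(2\sin t+\mathrm e^{p\cos t}\sin(-t+p\sin t)-\mathrm e^{-p\cos t}\sin(t+p\sin t))}.$$ For $0<p<\pi$, $HH(p,t)$ is finite (its denominator does not vanish) and positive for all $t\in(0,\pi)$, it is integrable in $t$ over $[0,\pi]$, the argument of the logarithm in $H(p)$ is positive, and $H(p)$ is finite and positive. The estimate extends to $p=0$ with $H(0)=0$: if $\mathrm{CR}(A)\subset\exp\overline{\mathrm D}(0,0)=\{1\}$, then $\log A$ is well-defined and $\|\log A\|_2\le 0$. -/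

import Mathlib

namespace ConformalRange

noncomputable section

variable {𝕜 E : Type*} [RCLike 𝕜] [NormedAddCommGroup E] [InnerProductSpace 𝕜 E]

/-- The real scalar product `⟨y, x⟩_real = Re ⟨y, x⟩` underlying the scalar product of `E`. -/
def realInner (𝕜 : Type*) {E : Type*} [RCLike 𝕜] [NormedAddCommGroup E]
    [InnerProductSpace 𝕜 E] (y x : E) : ℝ :=
  RCLike.re (inner 𝕜 y x)

/-- The complex number `y : x` (meant for `x ≠ 0`), which records the real orthogonal
decomposition of `y` with respect to `x`:
`⟨y,x⟩_real / |x|² + i | y/|x| - (⟨y,x⟩_real / |x|²) x/|x| |`. -/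
def ratio (𝕜 : Type*) {E : Type*} [RCLike 𝕜] [NormedAddCommGroup E]
    [InnerProductSpace 𝕜 E] (y x : E) : ℂ :=
  ⟨realInner 𝕜 y x / ‖x‖ ^ 2,
    ‖((‖x‖⁻¹ : ℝ) : 𝕜) • y
      - ((realInner 𝕜 y x / ‖x‖ ^ 2 : ℝ) : 𝕜) • (((‖x‖⁻¹ : ℝ) : 𝕜) • x)‖⟩

/-- The conformal range: all `Ax : x` and their complex conjugates, for `x ≠ 0`. -/
def conformalRange (A : E →L[𝕜] E) : Set ℂ :=
  {z | ∃ x : E, x ≠ 0 ∧ (z = ratio 𝕜 (A x) x ∨ z = starRingEnd ℂ (ratio 𝕜 (A x) x))}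

/-- The point `(1 - t) Id + t A` of the segment from `Id` to `A`. -/
def segmentPoint (A : E →L[𝕜] E) (t : ℝ) : E →L[𝕜] E :=
  ((1 - t : ℝ) : 𝕜) • (1 : E →L[𝕜] E) + (t : 𝕜) • A

/-- `log A` is well defined: the segment from `Id` to `A` contains only invertible operators
(equivalently, the spectrum of `A` does not meet `(-∞, 0]`). -/
def IsLogable (A : E →L[𝕜] E) : Prop :=
  ∀ t ∈ Set.Icc (0 : ℝ) 1, IsUnit (segmentPoint A t)

/-- The principal logarithm `log A = ∫_0^1 (A - Id) ((1 - t) Id + t A)⁻¹ dt`, a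
Bochner integral in the (real) Banach space of bounded operators. -/
def opLog (A : E →L[𝕜] E) : E →L[𝕜] E :=
  letI : NormedSpace ℝ (E →L[𝕜] E) := NormedSpace.restrictScalars ℝ 𝕜 (E →L[𝕜] E)
  ∫ t in (0 : ℝ)..1, (A - 1) * Ring.inverse (segmentPoint A t)

open Real in
/-- The denominator of the kernel `HH`. -/
def HHden (p t : ℝ) : ℝ :=
  sin (p * sin t) *
    (2 * sin t + exp (p * cos t) * sin (-t + p * sin t)
      - exp (-(p * cos t)) * sin (t + p * sin t))

open Real in
/-- The kernel `HH(p, t)`. -/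
def HH (p t : ℝ) : ℝ :=
  (sin (p * sin t) - p * sin t * cos (p * sin t)) *
    (exp (p * cos t) + exp (-(p * cos t)) - 2 * cos (p * sin t)) / HHden p t

open Real in
/-- The argument of the logarithm in `H(p)`. -/
def HlogArg (p : ℝ) : ℝ :=
  2 * cosh (p / 2) - 2 / p * sinh (p / 2)

/-- The growth function `H(p)`. -/
def H (p : ℝ) : ℝ :=
  p - 2 * Real.log (HlogArg p) + ∫ t in (0 : ℝ)..Real.pi, HH p t

end

end ConformalRange

namespace ConformalRange

noncomputable section

open Real Set

/-! ### Elementary inequalities -/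

/-! For real `a`, `b` the norm of `a x + b A x` is `|a + b z| ‖x‖` with `z = A x : x`
(`norm_smul_add_smul_eq`). So operator bounds along the segment from `Id` to `A` reduce to bounds on
complex numbers `z = e^w`, `|w| ≤ p`: the integrand of `log A` at `t` has norm at most the supremum
of `|e^w - 1| / |1 - t + t e^w|`. The denominator has no zero because `|Im w| < π`; compactness then
bounds it below, which gives invertibility along the segment (`isLogable_of_bounded_below`).

By the maximum principle the supremum is attained on `|w| = p`. With `τ = 2t - 1`, `(1 - t + t e^w)
/ (e^w - 1) = (τ + coth(w/2)) / 2`, so the supremum is at most 2 over the distance from `τ` to the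
curve `-coth(w/2)`, and `‖log A‖` is at most the integral of the inverse distance over `τ ∈ [-1,
1]`.

This integral is `H(p)` (`integral_inv_curveDist`). The normal of the curve at angle `θ` meets the
real axis at `criticalPoint p θ`, which increases with `θ`; hence the nearest curve point to `τ` is
the foot of the normal through `τ`, or an endpoint of the arc if there is none. Substituting `τ =
criticalPoint p θ` turns the middle range into the integral of `HH`; on the two outer ranges the
distance is affine in `τ`, which gives the logarithms. -/

theorem sinh_lt_mul_cosh {x : ℝ} (hx : 0 < x) : sinh x < x * cosh x := by
  have h : StrictMonoOn (fun y : ℝ => y * cosh y - sinh y) (Ici 0) := by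
    refine strictMonoOn_of_deriv_pos (convex_Ici 0) (by fun_prop) fun y hy => ?_
    rw [interior_Ici] at hy
    have hd : HasDerivAt (fun y : ℝ => y * cosh y - sinh y)
        (1 * cosh y + y * sinh y - cosh y) y :=
      ((hasDerivAt_id y).mul (hasDerivAt_cosh y)).sub (hasDerivAt_sinh y)
    rw [hd.deriv]
    have := mul_pos (mem_Ioi.1 hy) (sinh_pos_iff.2 hy)
    linarith
  have := h self_mem_Ici hx.le hx
  simp at this
  exact this

theorem cosh_sub_one_lt_mul_sinh {x : ℝ} (hx : x ≠ 0) : cosh x - 1 < x * sinh x := by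
  have key : ∀ y : ℝ, 0 < y → cosh y - 1 < y * sinh y := by
    intro y hy
    have h1 := sinh_lt_mul_cosh (half_pos hy)
    have hs : 0 < sinh (y / 2) := sinh_pos_iff.2 (half_pos hy)
    have hc := cosh_pos (y / 2)
    have e1 : cosh y = 1 + 2 * sinh (y / 2) ^ 2 := by
      have := cosh_two_mul (y / 2)
      rw [mul_div_cancel₀ y two_ne_zero] at this
      rw [this, cosh_sq]; ring
    have e2 : sinh y = 2 * sinh (y / 2) * cosh (y / 2) := by
      rw [← sinh_two_mul, mul_div_cancel₀ y two_ne_zero]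
    rw [e1, e2]
    have h2 : 0 < y / 2 * cosh (y / 2) := by positivity
    nlinarith [mul_lt_mul_of_pos_left h1 hs, mul_pos hs h2]
  rcases hx.lt_or_gt with h | h
  · have := key (-x) (by linarith)
    rw [cosh_neg, sinh_neg] at this
    linarith
  · exact key x h

theorem mul_cos_lt_sin {v : ℝ} (h0 : 0 < v) (h1 : v < π) : v * cos v < sin v := by
  have h : StrictMonoOn (fun y : ℝ => sin y - y * cos y) (Icc 0 π) := by
    refine strictMonoOn_of_deriv_pos (convex_Icc 0 π) (by fun_prop) fun y hy => ?_
    rw [interior_Icc] at hy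
    have hd : HasDerivAt (fun y : ℝ => sin y - y * cos y)
        (cos y - (1 * cos y + y * (-sin y))) y :=
      (hasDerivAt_sin y).sub ((hasDerivAt_id y).mul (hasDerivAt_cos y))
    rw [hd.deriv]
    have := mul_pos hy.1 (sin_pos_of_pos_of_lt_pi hy.1 hy.2)
    linarith
  have := h ⟨le_rfl, pi_pos.le⟩ ⟨h0.le, h1.le⟩ h0
  simp at this
  exact this

theorem cos_lt_cosh {u v : ℝ} (h : u ≠ 0 ∨ (v ≠ 0 ∧ |v| < π)) : cos v < cosh u := by
  rcases h with h | ⟨h0, h1⟩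
  · exact (cos_le_one v).trans_lt (one_lt_cosh.2 h)
  · refine lt_of_lt_of_le ?_ (one_le_cosh u)
    rw [← cos_abs, ← cos_zero]
    exact cos_lt_cos_of_nonneg_of_le_pi le_rfl h1.le (abs_pos.2 h0)

/-- The expression is a sum of three nonnegative terms: `(u sinh u - (cosh u - 1)) sinc v`, `(cosh u
- 1)(sinc v - cos v)` and `1 - cos v`. Using `sinc` keeps the case `v = 0`, that is, the endpoints
of the arc. -/
theorem one_sub_cosh_mul_cos_add_pos {u v : ℝ} (h0 : 0 ≤ v) (h1 : v < π) (h : u ≠ 0 ∨ v ≠ 0) :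
    0 < 1 - cosh u * cos v + u * sinh u * sinc v := by
  have hu0 : cosh u - 1 ≤ u * sinh u := by
    rcases eq_or_ne u 0 with rfl | hu
    · simp
    · exact (cosh_sub_one_lt_mul_sinh hu).le
  have hc1 := one_le_cosh u
  rcases h0.eq_or_lt with rfl | hv
  · have hu : u ≠ 0 := by simpa using h
    have := cosh_sub_one_lt_mul_sinh hu
    simp only [cos_zero, sinc_zero]; linarith
  · have hs : sinc v = sin v / v := sinc_of_ne_zero hv.ne'
    have hs0 : 0 < sinc v := by
      rw [hs]; exact div_pos (sin_pos_of_pos_of_lt_pi hv h1) hv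
    have hs1 : cos v < sinc v := by
      rw [hs, lt_div_iff₀ hv, mul_comm]; exact mul_cos_lt_sin hv h1
    have hcos : cos v < 1 := by
      simpa using cos_lt_cosh (u := 0) (v := v) (Or.inr ⟨hv.ne', by rwa [abs_of_pos hv]⟩)
    nlinarith [mul_nonneg (sub_nonneg.2 hu0) hs0.le, mul_nonneg (sub_nonneg.2 hc1) (sub_pos.2 hs1).le]

/-! ### The boundary curve and its critical points -/

/-- `cosh u - cos v` at the point `u + iv = p e^{iθ}`. -/
def chordSq (p θ : ℝ) : ℝ := cosh (p * cos θ) - cos (p * sin θ)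

/-- The curve `-coth (w̄ / 2)`, `w = p e^{iθ}`. -/
def cothCurve (p θ : ℝ) : ℂ :=
  ⟨-(sinh (p * cos θ) / chordSq p θ), sin (p * sin θ) / chordSq p θ⟩

/-- The squared distance of the real point `τ` to `cothCurve p θ`. -/
def curveDistSq (p τ θ : ℝ) : ℝ :=
  τ ^ 2 + 2 * τ * (sinh (p * cos θ) / chordSq p θ) + (1 + 2 * (cos (p * sin θ) / chordSq p θ))

/-- The numerator of `criticalPoint`, up to the factor `p sin θ`. -/
def criticalNum (p θ : ℝ) : ℝ :=
  p * sin θ * cos (p * sin θ) * sinh (p * cos θ) - p * cos θ * sin (p * sin θ) * cosh (p * cos θ)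

/-- The denominator of `criticalPoint`, up to the factor `p sin θ`. -/
def criticalDen (p θ : ℝ) : ℝ :=
  p * sin θ * (1 - cosh (p * cos θ) * cos (p * sin θ))
    + p * cos θ * sinh (p * cos θ) * sin (p * sin θ)

/-- The point where the normal of `cothCurve p` at `θ` meets the real axis. -/
def criticalPoint (p θ : ℝ) : ℝ :=
  (cos (p * sin θ) * sinh (p * cos θ) - p * cos θ * sinc (p * sin θ) * cosh (p * cos θ)) /
    (1 - cosh (p * cos θ) * cos (p * sin θ) + p * cos θ * sinh (p * cos θ) * sinc (p * sin θ))

section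

variable {p : ℝ}

theorem mul_sin_lt_pi (h0 : 0 < p) (hp : p < π) (θ : ℝ) : p * sin θ < π :=
  (mul_le_of_le_one_right h0.le (sin_le_one θ)).trans_lt hp

theorem mul_cos_ne_zero_or (h0 : 0 < p) (θ : ℝ) : p * cos θ ≠ 0 ∨ p * sin θ ≠ 0 := by
  by_contra! h
  have h1 := sin_sq_add_cos_sq θ
  have h2 : cos θ = 0 := by simpa [h0.ne'] using h.1
  have h3 : sin θ = 0 := by simpa [h0.ne'] using h.2
  simp [h2, h3] at h1

theorem chordSq_pos (h0 : 0 < p) (hp : p < π) (θ : ℝ) : 0 < chordSq p θ := by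
  refine sub_pos.2 (cos_lt_cosh ?_)
  refine (mul_cos_ne_zero_or h0 θ).imp_right fun h => ⟨h, ?_⟩
  rw [abs_mul, abs_of_pos h0]
  exact (mul_le_of_le_one_right h0.le (abs_sin_le_one θ)).trans_lt hp

theorem mul_sin_pos (h0 : 0 < p) {θ : ℝ} (hθ : θ ∈ Ioo 0 π) : 0 < p * sin θ :=
  mul_pos h0 (sin_pos_of_mem_Ioo hθ)

theorem criticalPoint_den_pos (h0 : 0 < p) (hp : p < π) {θ : ℝ} (hθ : θ ∈ Icc 0 π) :
    0 < 1 - cosh (p * cos θ) * cos (p * sin θ)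
      + p * cos θ * sinh (p * cos θ) * sinc (p * sin θ) :=
  one_sub_cosh_mul_cos_add_pos (mul_nonneg h0.le (sin_nonneg_of_mem_Icc hθ)) (mul_sin_lt_pi h0 hp θ)
    (mul_cos_ne_zero_or h0 θ)

theorem criticalDen_eq (h0 : 0 < p) {θ : ℝ} (hθ : θ ∈ Ioo 0 π) :
    criticalDen p θ = p * sin θ * (1 - cosh (p * cos θ) * cos (p * sin θ)
      + p * cos θ * sinh (p * cos θ) * sinc (p * sin θ)) := by
  have hv := mul_sin_pos h0 hθ
  have hs := (sin_pos_of_mem_Ioo hθ).ne'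
  rw [sinc_of_ne_zero hv.ne', criticalDen]
  field_simp

theorem criticalDen_pos_of_mem_Ioo (h0 : 0 < p) (hp : p < π) {θ : ℝ} (hθ : θ ∈ Ioo 0 π) :
    0 < criticalDen p θ := by
  rw [criticalDen_eq h0 hθ]
  exact mul_pos (mul_sin_pos h0 hθ) (criticalPoint_den_pos h0 hp (Ioo_subset_Icc_self hθ))

theorem criticalPoint_eq (h0 : 0 < p) {θ : ℝ} (hθ : θ ∈ Ioo 0 π) :
    criticalPoint p θ = criticalNum p θ / criticalDen p θ := by
  have hv := mul_sin_pos h0 hθ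
  have hn : criticalNum p θ = p * sin θ * (cos (p * sin θ) * sinh (p * cos θ)
      - p * cos θ * sinc (p * sin θ) * cosh (p * cos θ)) := by
    have hs := (sin_pos_of_mem_Ioo hθ).ne'
    rw [sinc_of_ne_zero hv.ne', criticalNum]
    field_simp
  rw [hn, criticalDen_eq h0 hθ, mul_div_mul_left _ _ hv.ne', criticalPoint]

/-! ### Derivatives and monotonicity of the critical point -/

theorem hasDerivAt_mul_cos (p θ : ℝ) :
    HasDerivAt (fun x => p * cos x) (-(p * sin θ)) θ := by
  simpa using (hasDerivAt_cos θ).const_mul p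

theorem hasDerivAt_mul_sin (p θ : ℝ) : HasDerivAt (fun x => p * sin x) (p * cos θ) θ :=
  (hasDerivAt_sin θ).const_mul p

theorem hasDerivAt_chordSq (p θ : ℝ) :
    HasDerivAt (chordSq p)
      (sinh (p * cos θ) * -(p * sin θ) - -sin (p * sin θ) * (p * cos θ)) θ :=
  (hasDerivAt_mul_cos p θ).cosh.sub (hasDerivAt_mul_sin p θ).cos

theorem hasDerivAt_criticalNum (p θ : ℝ) :
    HasDerivAt (criticalNum p)
      (p * cos θ * cos (p * sin θ) * sinh (p * cos θ)
        + p * sin θ * sin (p * sin θ) * cosh (p * cos θ)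
        - p ^ 2 * cos (p * sin θ) * cosh (p * cos θ)) θ := by
  have hu := hasDerivAt_mul_cos p θ
  have hv := hasDerivAt_mul_sin p θ
  convert! ((hv.mul hv.cos).mul hu.sinh).sub ((hu.mul hv.sin).mul hu.cosh) using 1
  simp only [Pi.mul_apply]
  linear_combination (p ^ 2 * cos (p * sin θ) * cosh (p * cos θ)) * sin_sq_add_cos_sq θ

theorem hasDerivAt_criticalDen (p θ : ℝ) :
    HasDerivAt (criticalDen p)
      (p * cos θ * (1 - cosh (p * cos θ) * cos (p * sin θ))
        - p * sin θ * sinh (p * cos θ) * sin (p * sin θ)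
        + p ^ 2 * cos (p * sin θ) * sinh (p * cos θ)) θ := by
  have hu := hasDerivAt_mul_cos p θ
  have hv := hasDerivAt_mul_sin p θ
  convert! (hv.mul ((hu.cosh.mul hv.cos).const_sub 1)).add ((hu.mul hu.sinh).mul hv.sin) using 1
  simp only [Pi.mul_apply]
  linear_combination (p ^ 2 * cos (p * sin θ) * sinh (p * cos θ)) * (-sin_sq_add_cos_sq θ)

theorem hasDerivAt_criticalPoint (h0 : 0 < p) (hp : p < π) {θ : ℝ} (hθ : θ ∈ Ioo 0 π) :
    HasDerivAt (criticalPoint p)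
      (p ^ 2 * chordSq p θ * (sin (p * sin θ) - p * sin θ * cos (p * sin θ))
        / criticalDen p θ ^ 2) θ := by
  have h := (hasDerivAt_criticalNum p θ).div (hasDerivAt_criticalDen p θ)
    (criticalDen_pos_of_mem_Ioo h0 hp hθ).ne'
  -- Near an interior angle the `sinc`-free quotient applies, so `sinc` is never differentiated.
  have h' := h.congr_of_eventuallyEq (f₁ := criticalPoint p) (by
    filter_upwards [isOpen_Ioo.mem_nhds hθ] with x hx
    exact criticalPoint_eq h0 hx)
  convert! h' using 2
  rw [criticalDen, criticalNum, chordSq]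
  have h1 := sin_sq_add_cos_sq θ
  have h2 := cosh_sq (p * cos θ)
  have h3 : p ^ 2 = (p * cos θ) ^ 2 + (p * sin θ) ^ 2 := by linear_combination (-p ^ 2) * h1
  generalize cosh (p * cos θ) = a at *
  generalize sinh (p * cos θ) = b at *
  generalize cos (p * sin θ) = c at *
  generalize sin (p * sin θ) = s at *
  generalize p * cos θ = u at *
  generalize p * sin θ = v at *
  rw [h3]
  linear_combination ((u ^ 2 + v ^ 2) * s * c - c ^ 2 * v * (u ^ 2 + v ^ 2)) * h2

theorem continuousOn_criticalPoint (h0 : 0 < p) (hp : p < π) :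
    ContinuousOn (criticalPoint p) (Icc 0 π) := by
  have hs : Continuous fun θ => sinc (p * sin θ) := continuous_sinc.comp (by fun_prop)
  exact ContinuousOn.div (by fun_prop) (by fun_prop)
    fun θ hθ => (criticalPoint_den_pos h0 hp hθ).ne'

theorem deriv_criticalPoint_pos (h0 : 0 < p) (hp : p < π) {θ : ℝ} (hθ : θ ∈ Ioo 0 π) :
    0 < p ^ 2 * chordSq p θ * (sin (p * sin θ) - p * sin θ * cos (p * sin θ))
        / criticalDen p θ ^ 2 := by
  have h1 := chordSq_pos h0 hp θ
  have h2 := sub_pos.2 (mul_cos_lt_sin (mul_sin_pos h0 hθ) (mul_sin_lt_pi h0 hp θ))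
  have h3 := criticalDen_pos_of_mem_Ioo h0 hp hθ
  positivity

theorem strictMonoOn_criticalPoint (h0 : 0 < p) (hp : p < π) :
    StrictMonoOn (criticalPoint p) (Icc 0 π) := by
  refine strictMonoOn_of_deriv_pos (convex_Icc 0 π) (continuousOn_criticalPoint h0 hp) fun θ hθ => ?_
  rw [interior_Icc] at hθ
  rw [(hasDerivAt_criticalPoint h0 hp hθ).deriv]
  exact deriv_criticalPoint_pos h0 hp hθ

/-! ### The distance from a real point to the curve -/

theorem hasDerivAt_curveDistSq (h0 : 0 < p) (hp : p < π) (τ θ : ℝ) :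
    HasDerivAt (curveDistSq p τ)
      (2 * (criticalNum p θ - τ * criticalDen p θ) / chordSq p θ ^ 2) θ := by
  have hQ := (chordSq_pos h0 hp θ).ne'
  have hu := hasDerivAt_mul_cos p θ
  have hv := hasDerivAt_mul_sin p θ
  have hq := hasDerivAt_chordSq p θ
  convert! (((hu.sinh.div hq hQ).const_mul (2 * τ)).const_add (τ ^ 2)).add
    (((hv.cos.div hq hQ).const_mul 2).const_add 1) using 1
  field_simp
  rw [criticalDen, criticalNum, chordSq]
  linear_combination (τ * p * sin θ) * cosh_sq (p * cos θ)

/-- The derivative in `θ` has the sign of `criticalPoint p θ - τ`, so the squared distance falls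
before `θ₀` and rises after it. One-sided hypotheses on open intervals let `θ₀` be an endpoint as
well. -/
theorem curveDistSq_min (h0 : 0 < p) (hp : p < π) {τ θ₀ : ℝ} (hθ₀ : θ₀ ∈ Icc 0 π)
    (hl : ∀ θ ∈ Ioo 0 θ₀, criticalPoint p θ ≤ τ) (hr : ∀ θ ∈ Ioo θ₀ π, τ ≤ criticalPoint p θ)
    {θ : ℝ} (hθ : θ ∈ Icc 0 π) : curveDistSq p τ θ₀ ≤ curveDistSq p τ θ := by
  have hd := hasDerivAt_curveDistSq h0 hp τ
  have hc : Continuous (curveDistSq p τ) :=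
    continuous_iff_continuousAt.2 fun x => (hd x).continuousAt
  rcases le_total θ θ₀ with h | h
  · refine antitoneOn_of_deriv_nonpos (convex_Icc 0 θ₀) hc.continuousOn
      (fun x _ => (hd x).differentiableAt.differentiableWithinAt) (fun x hx => ?_)
      ⟨hθ.1, h⟩ ⟨hθ₀.1, le_rfl⟩ h
    rw [interior_Icc] at hx
    have hx' : x ∈ Ioo 0 π := ⟨hx.1, hx.2.trans_le hθ₀.2⟩
    have h1 := hl x hx
    rw [criticalPoint_eq h0 hx', div_le_iff₀ (criticalDen_pos_of_mem_Ioo h0 hp hx')] at h1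
    rw [(hd x).deriv]
    exact div_nonpos_of_nonpos_of_nonneg (by linarith) (sq_nonneg _)
  · refine monotoneOn_of_deriv_nonneg (convex_Icc θ₀ π) hc.continuousOn
      (fun x _ => (hd x).differentiableAt.differentiableWithinAt) (fun x hx => ?_)
      ⟨le_rfl, hθ₀.2⟩ ⟨h, hθ.2⟩ h
    rw [interior_Icc] at hx
    have hx' : x ∈ Ioo 0 π := ⟨hθ₀.1.trans_lt hx.1, hx.2⟩
    have h1 := hr x hx
    rw [criticalPoint_eq h0 hx', le_div_iff₀ (criticalDen_pos_of_mem_Ioo h0 hp hx')] at h1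
    rw [(hd x).deriv]
    exact div_nonneg (by linarith) (sq_nonneg _)

/-- The squared modulus of the curve point is `(cosh u + cos v) / (cosh u - cos v)`, where `u + iv =
p e^{iθ}`. -/
theorem dist_cothCurve_sq (h0 : 0 < p) (hp : p < π) (τ θ : ℝ) :
    dist (τ : ℂ) (cothCurve p θ) ^ 2 = curveDistSq p τ θ := by
  have hQ := (chordSq_pos h0 hp θ).ne'
  rw [Complex.dist_eq, Complex.sq_norm, Complex.normSq_apply]
  simp only [cothCurve, Complex.sub_re, Complex.sub_im, Complex.ofReal_re, Complex.ofReal_im,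
    curveDistSq]
  have h1 := sin_sq_add_cos_sq (p * sin θ)
  have h2 := cosh_sq (p * cos θ)
  field_simp
  rw [chordSq]
  linear_combination h1 - h2

/-- The distance of the real point `τ` to the boundary curve. -/
def curveDist (p τ : ℝ) : ℝ := Metric.infDist (τ : ℂ) (cothCurve p '' Icc 0 π)

theorem continuous_curveDist (p : ℝ) : Continuous (curveDist p) :=
  (Metric.continuous_infDist_pt _).comp Complex.continuous_ofReal

theorem curveDist_eq (h0 : 0 < p) (hp : p < π) {τ θ₀ : ℝ} (hθ₀ : θ₀ ∈ Icc 0 π)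
    (hl : ∀ θ ∈ Ioo 0 θ₀, criticalPoint p θ ≤ τ) (hr : ∀ θ ∈ Ioo θ₀ π, τ ≤ criticalPoint p θ) :
    curveDist p τ = √(curveDistSq p τ θ₀) := by
  have hd : ∀ θ, dist (τ : ℂ) (cothCurve p θ) = √(curveDistSq p τ θ) := fun θ => by
    rw [← dist_cothCurve_sq h0 hp, Real.sqrt_sq dist_nonneg]
  refine le_antisymm ?_ ?_
  · rw [← hd]; exact Metric.infDist_le_dist_of_mem (mem_image_of_mem _ hθ₀)
  · refine (Metric.le_infDist ⟨_, mem_image_of_mem _ hθ₀⟩).2 ?_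
    rintro _ ⟨θ, hθ, rfl⟩
    rw [hd]
    exact Real.sqrt_le_sqrt (curveDistSq_min h0 hp hθ₀ hl hr hθ)

theorem curveDist_criticalPoint (h0 : 0 < p) (hp : p < π) {θ : ℝ} (hθ : θ ∈ Ioo 0 π) :
    curveDist p (criticalPoint p θ) = p * sin (p * sin θ) / criticalDen p θ := by
  have hm := (strictMonoOn_criticalPoint h0 hp).monotoneOn
  have hI := Ioo_subset_Icc_self hθ
  rw [curveDist_eq h0 hp hI
    (fun x hx => hm ⟨hx.1.le, hx.2.le.trans hI.2⟩ hI hx.2.le)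
    (fun x hx => hm hI ⟨hI.1.trans hx.1.le, hx.2.le⟩ hx.1.le)]
  have hP := criticalDen_pos_of_mem_Ioo h0 hp hθ
  have hs : 0 < sin (p * sin θ) :=
    sin_pos_of_pos_of_lt_pi (mul_sin_pos h0 hθ) (mul_sin_lt_pi h0 hp θ)
  rw [← Real.sqrt_sq (show 0 ≤ p * sin (p * sin θ) / criticalDen p θ by positivity)]
  congr 1
  rw [← dist_cothCurve_sq h0 hp, Complex.dist_eq, Complex.sq_norm, Complex.normSq_apply,
    criticalPoint_eq h0 hθ]
  simp only [cothCurve, Complex.sub_re, Complex.sub_im, Complex.ofReal_re, Complex.ofReal_im]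
  have hQ := chordSq_pos h0 hp θ
  have h1 := sin_sq_add_cos_sq (p * sin θ)
  have h2 := cosh_sq (p * cos θ)
  have h4 := sin_sq_add_cos_sq θ
  have h3 : p ^ 2 = (p * cos θ) ^ 2 + (p * sin θ) ^ 2 := by linear_combination (-p ^ 2) * h4
  have e1 : criticalNum p θ * chordSq p θ + sinh (p * cos θ) * criticalDen p θ =
      -(sin (p * sin θ) * (p * cos θ * (1 - cosh (p * cos θ) * cos (p * sin θ))
        - p * sin θ * sinh (p * cos θ) * sin (p * sin θ))) := by
    rw [criticalDen, criticalNum, chordSq]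
    linear_combination (-p * sin θ * sinh (p * cos θ)) * h1
      - (p * cos θ * sin (p * sin θ)) * h2
  -- Multiplicativity of the modulus for `w = u + iv` and the conjugate of `1 - cosh w`, together
  -- with `|1 - cosh w| = cosh u - cos v`.
  have e2 : (p * cos θ * (1 - cosh (p * cos θ) * cos (p * sin θ))
        - p * sin θ * sinh (p * cos θ) * sin (p * sin θ)) ^ 2 + criticalDen p θ ^ 2
      = p ^ 2 * chordSq p θ ^ 2 := by
    rw [criticalDen, chordSq, h3]
    have : (1 - cosh (p * cos θ) * cos (p * sin θ)) ^ 2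
        + sinh (p * cos θ) ^ 2 * sin (p * sin θ) ^ 2
        = (cosh (p * cos θ) - cos (p * sin θ)) ^ 2 := by
      linear_combination (sinh (p * cos θ) ^ 2) * h1 + (cos (p * sin θ) ^ 2 - 1) * h2
    linear_combination ((p * cos θ) ^ 2 + (p * sin θ) ^ 2) * this
  have e3 : criticalNum p θ / criticalDen p θ - -(sinh (p * cos θ) / chordSq p θ)
      = (criticalNum p θ * chordSq p θ + sinh (p * cos θ) * criticalDen p θ)
        / (criticalDen p θ * chordSq p θ) := by
    field_simp
    ring
  rw [e3, e1]
  field_simp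
  linear_combination (sin (p * sin θ)) ^ 2 * e2

end

end

end ConformalRange

namespace ConformalRange

noncomputable section

open Set

variable {𝕜 E : Type*} [RCLike 𝕜] [NormedAddCommGroup E] [InnerProductSpace 𝕜 E]

/-! ### Norms of real affine combinations and the conformal range -/

theorem norm_smul_add_smul_sq (a b : ℝ) (x y : E) :
    ‖(a : 𝕜) • x + (b : 𝕜) • y‖ ^ 2
      = a ^ 2 * ‖x‖ ^ 2 + 2 * a * b * realInner 𝕜 y x + b ^ 2 * ‖y‖ ^ 2 := by
  rw [@norm_add_sq 𝕜, norm_smul, norm_smul, inner_smul_left, inner_smul_right, RCLike.norm_ofReal,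
    RCLike.norm_ofReal, RCLike.conj_ofReal, mul_pow, mul_pow, sq_abs, sq_abs, realInner,
    RCLike.re_ofReal_mul, RCLike.re_ofReal_mul, inner_re_symm]
  ring

theorem norm_smul_add_smul_eq (a b : ℝ) {x : E} (hx : x ≠ 0) (y : E) :
    ‖(a : 𝕜) • x + (b : 𝕜) • y‖ = ‖(a + b * ratio 𝕜 y x : ℂ)‖ * ‖x‖ := by
  have hx' : ‖x‖ ≠ 0 := norm_ne_zero_iff.2 hx
  have him : (ratio 𝕜 y x).im ^ 2 = ‖y‖ ^ 2 / ‖x‖ ^ 2 - (realInner 𝕜 y x / ‖x‖ ^ 2) ^ 2 := by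
    -- Written as a real combination of `x` and `y`, the imaginary part falls under
    -- `norm_smul_add_smul_sq` too.
    have : ratio 𝕜 y x = ⟨realInner 𝕜 y x / ‖x‖ ^ 2,
      ‖((-(realInner 𝕜 y x / ‖x‖ ^ 2 * ‖x‖⁻¹) : ℝ) : 𝕜) • x + ((‖x‖⁻¹ : ℝ) : 𝕜) • y‖⟩ := by
      rw [ratio, smul_smul, sub_eq_neg_add, ← neg_smul]
      push_cast
      rfl
    rw [this]
    simp only
    rw [norm_smul_add_smul_sq]
    field_simp
    ring
  refine (sq_eq_sq₀ (norm_nonneg _) (by positivity)).1 ?_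
  rw [norm_smul_add_smul_sq, mul_pow, Complex.sq_norm, Complex.normSq_apply]
  have hre : (ratio 𝕜 y x).re = realInner 𝕜 y x / ‖x‖ ^ 2 := rfl
  simp only [Complex.add_re, Complex.add_im, Complex.ofReal_re, Complex.ofReal_im, Complex.mul_re,
    Complex.mul_im, zero_mul, sub_zero, add_zero, zero_add, hre]
  have : (a + b * (realInner 𝕜 y x / ‖x‖ ^ 2)) * (a + b * (realInner 𝕜 y x / ‖x‖ ^ 2))
      + b * (ratio 𝕜 y x).im * (b * (ratio 𝕜 y x).im)
      = a ^ 2 + 2 * a * b * (realInner 𝕜 y x / ‖x‖ ^ 2) + b ^ 2 * (‖y‖ ^ 2 / ‖x‖ ^ 2) := by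
    linear_combination (b ^ 2) * him
  rw [this]
  field_simp

theorem ratio_mem_conformalRange (A : E →L[𝕜] E) {x : E} (hx : x ≠ 0) :
    ratio 𝕜 (A x) x ∈ conformalRange A := ⟨x, hx, Or.inl rfl⟩

theorem segmentPoint_apply (A : E →L[𝕜] E) (t : ℝ) (x : E) :
    segmentPoint A t x = ((1 - t : ℝ) : 𝕜) • x + (t : 𝕜) • A x := rfl

theorem norm_segmentPoint_apply (A : E →L[𝕜] E) (t : ℝ) {x : E} (hx : x ≠ 0) :
    ‖segmentPoint A t x‖ = ‖(1 - t + t * ratio 𝕜 (A x) x : ℂ)‖ * ‖x‖ := by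
  rw [segmentPoint_apply, norm_smul_add_smul_eq _ _ hx]
  push_cast
  rfl

theorem norm_sub_one_apply (A : E →L[𝕜] E) {x : E} (hx : x ≠ 0) :
    ‖(A - 1) x‖ = ‖ratio 𝕜 (A x) x - 1‖ * ‖x‖ := by
  have := norm_smul_add_smul_eq (𝕜 := 𝕜) (-1) 1 hx (A x)
  simpa [sub_eq_neg_add] using this

/-! ### The logarithm -/

theorem continuous_segmentPoint (A : E →L[𝕜] E) : Continuous (segmentPoint A) := by
  have h : Continuous ((↑) : ℝ → 𝕜) := RCLike.continuous_ofReal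
  exact ((h.comp (by fun_prop)).smul continuous_const).add (h.smul continuous_const)

theorem norm_unit_inv_le {T : (E →L[𝕜] E)ˣ} {c : ℝ} (hc : 0 < c)
    (h : ∀ x, c * ‖x‖ ≤ ‖(T : E →L[𝕜] E) x‖) : ‖((T⁻¹ : (E →L[𝕜] E)ˣ) : E →L[𝕜] E)‖ ≤ c⁻¹ := by
  refine ContinuousLinearMap.opNorm_le_bound _ (inv_nonneg.2 hc.le) fun y => ?_
  have := h (((T⁻¹ : (E →L[𝕜] E)ˣ) : E →L[𝕜] E) y)
  rw [← mul_apply_eq_comp, T.mul_inv, one_apply_eq_self] at this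
  rw [inv_mul_eq_div, le_div_iff₀ hc, mul_comm]
  exact this

/-- A continuity argument: the parameters with invertible segment point form an open set containing
0. The uniform lower bound controls the inverses, so the set is also relatively closed in the
connected interval. -/
theorem isLogable_of_bounded_below [CompleteSpace E] (A : E →L[𝕜] E) {c : ℝ} (hc : 0 < c)
    (h : ∀ t ∈ Icc (0 : ℝ) 1, ∀ x, c * ‖x‖ ≤ ‖segmentPoint A t x‖) : IsLogable A := by
  have hcont := continuous_segmentPoint A
  let U : Set ℝ := {t | IsUnit (segmentPoint A t)}
  have hU : IsOpen U := Units.isOpen.preimage hcont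
  have hclosed : closure U ∩ Icc 0 1 ⊆ U := by
    rintro t ⟨ht, ht'⟩
    rcases subsingleton_or_nontrivial E with hE | hE
    · exact isUnit_of_subsingleton _
    obtain ⟨s, hs, hsU⟩ := mem_closure_iff_nhds.1 ht _
      (hcont.continuousAt.preimage_mem_nhds (Metric.ball_mem_nhds _ (half_pos hc)))
    rw [mem_preimage, Metric.mem_ball, dist_eq_norm] at hs
    obtain ⟨T, hT⟩ := hsU
    -- The nearby parameter `s` may lie outside `[0, 1]`, so its lower bound is inherited from `t`
    -- at the cost of half the constant.
    have hbound : ∀ x, c / 2 * ‖x‖ ≤ ‖(T : E →L[𝕜] E) x‖ := fun x => by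
      have h1 := h t ht' x
      have h2 := ContinuousLinearMap.le_of_opNorm_le _ hs.le x
      have h3 := norm_sub_norm_le (segmentPoint A t x) (segmentPoint A s x)
      rw [sub_apply, norm_sub_rev] at h2
      rw [hT]
      linarith
    have hinv := norm_unit_inv_le (half_pos hc) hbound
    refine (Units.ofNearby T (segmentPoint A t) ?_).isUnit
    rw [hT, norm_sub_rev]
    exact hs.trans_le (le_inv_of_le_inv₀ (norm_pos_iff.2 T⁻¹.ne_zero) hinv)
  refine isPreconnected_Icc.subset_of_closure_inter_subset hU ⟨0, by simp, ?_⟩ hclosed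
  change IsUnit (segmentPoint A 0)
  simp [segmentPoint]

theorem norm_opLog_le [CompleteSpace E] (A : E →L[𝕜] E) (hA : IsLogable A) {B : ℝ → ℝ}
    (hB : IntervalIntegrable B MeasureTheory.volume 0 1)
    (hB0 : ∀ t ∈ Icc (0 : ℝ) 1, 0 ≤ B t)
    (h : ∀ t ∈ Icc (0 : ℝ) 1, ∀ x, ‖(A - 1) x‖ ≤ B t * ‖segmentPoint A t x‖) :
    ‖opLog A‖ ≤ ∫ t in (0 : ℝ)..1, B t := by
  let _ : NormedSpace ℝ (E →L[𝕜] E) := NormedSpace.restrictScalars ℝ 𝕜 (E →L[𝕜] E)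
  refine intervalIntegral.norm_integral_le_of_norm_le zero_le_one
    (Filter.Eventually.of_forall fun t ht => ?_) hB
  have ht' := Ioc_subset_Icc_self ht
  refine ContinuousLinearMap.opNorm_le_bound _ (hB0 t ht') fun y => ?_
  -- Test the hypothesis on the preimage of `y` under the segment point.
  have := h t ht' (Ring.inverse (segmentPoint A t) y)
  rwa [← mul_apply_eq_comp, ← mul_apply_eq_comp,
    Ring.mul_inverse_cancel _ (hA t ht'), one_apply_eq_self] at this

theorem isLogable_one : IsLogable (1 : E →L[𝕜] E) := fun t _ => by
  have : segmentPoint (1 : E →L[𝕜] E) t = 1 := by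
    rw [segmentPoint, ← add_smul]; push_cast; simp
  rw [this]; exact isUnit_one

theorem opLog_one : opLog (1 : E →L[𝕜] E) = 0 := by
  simp [opLog]

theorem eq_one_of_conformalRange_subset (A : E →L[𝕜] E) (h : conformalRange A ⊆ {1}) : A = 1 := by
  ext x
  rcases eq_or_ne x 0 with rfl | hx
  · simp
  · have h1 : ratio 𝕜 (A x) x = 1 := h (ratio_mem_conformalRange A hx)
    have h2 := norm_sub_one_apply A hx
    rw [h1, sub_self, norm_zero, zero_mul, norm_eq_zero] at h2
    exact sub_eq_zero.1 h2

end

end ConformalRange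

namespace ConformalRange

noncomputable section

open Real Set

variable {p : ℝ}

/-! ### The kernel `HH` as a Jacobian -/

theorem HHden_eq (h0 : 0 < p) (θ : ℝ) :
    HHden p θ = 2 * sin (p * sin θ) * criticalDen p θ / p := by
  rw [HHden, criticalDen, ← cosh_add_sinh, ← cosh_sub_sinh, sin_add, sin_add, sin_neg, cos_neg]
  field_simp
  ring

theorem HH_eq (h0 : 0 < p) (hp : p < π) {θ : ℝ} (hθ : θ ∈ Ioo 0 π) :
    HH p θ = p ^ 2 * chordSq p θ * (sin (p * sin θ) - p * sin θ * cos (p * sin θ))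
        / criticalDen p θ ^ 2 * (curveDist p (criticalPoint p θ))⁻¹ := by
  have hs : 0 < sin (p * sin θ) :=
    sin_pos_of_pos_of_lt_pi (mul_sin_pos h0 hθ) (mul_sin_lt_pi h0 hp θ)
  have hP := criticalDen_pos_of_mem_Ioo h0 hp hθ
  rw [curveDist_criticalPoint h0 hp hθ, HH, HHden_eq h0, ← cosh_add_sinh, ← cosh_sub_sinh, chordSq]
  field_simp
  ring

theorem HHden_pos (h0 : 0 < p) (hp : p < π) {θ : ℝ} (hθ : θ ∈ Ioo 0 π) : 0 < HHden p θ := by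
  have hs : 0 < sin (p * sin θ) :=
    sin_pos_of_pos_of_lt_pi (mul_sin_pos h0 hθ) (mul_sin_lt_pi h0 hp θ)
  have hP := criticalDen_pos_of_mem_Ioo h0 hp hθ
  rw [HHden_eq h0]
  positivity

theorem curveDist_criticalPoint_pos (h0 : 0 < p) (hp : p < π) {θ : ℝ} (hθ : θ ∈ Ioo 0 π) :
    0 < curveDist p (criticalPoint p θ) := by
  have hs : 0 < sin (p * sin θ) :=
    sin_pos_of_pos_of_lt_pi (mul_sin_pos h0 hθ) (mul_sin_lt_pi h0 hp θ)
  have hP := criticalDen_pos_of_mem_Ioo h0 hp hθ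
  rw [curveDist_criticalPoint h0 hp hθ]
  positivity

theorem HH_pos (h0 : 0 < p) (hp : p < π) {θ : ℝ} (hθ : θ ∈ Ioo 0 π) : 0 < HH p θ := by
  rw [HH_eq h0 hp hθ]
  exact mul_pos (deriv_criticalPoint_pos h0 hp hθ) (inv_pos.2 (curveDist_criticalPoint_pos h0 hp hθ))

theorem criticalPoint_pi (p : ℝ) : criticalPoint p π = -criticalPoint p 0 := by
  simp [criticalPoint]
  ring

theorem criticalPoint_image (h0 : 0 < p) (hp : p < π) :
    criticalPoint p '' Ioo 0 π = Ioo (criticalPoint p 0) (criticalPoint p π) := by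
  have hm := strictMonoOn_criticalPoint h0 hp
  refine Subset.antisymm ?_ (intermediate_value_Ioo pi_pos.le (continuousOn_criticalPoint h0 hp))
  rintro _ ⟨θ, hθ, rfl⟩
  have hI := Ioo_subset_Icc_self hθ
  exact ⟨hm ⟨le_rfl, pi_pos.le⟩ hI hθ.1, hm hI ⟨pi_pos.le, le_rfl⟩ hθ.2⟩

theorem criticalPoint_zero_lt (h0 : 0 < p) (hp : p < π) : criticalPoint p 0 < 0 := by
  have := strictMonoOn_criticalPoint h0 hp ⟨le_rfl, pi_pos.le⟩ ⟨pi_pos.le, le_rfl⟩ pi_pos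
  rw [criticalPoint_pi] at this
  linarith

/-- Clearing the denominator leaves `(1 + p) e^{-p} ≤ 1`. It places the range of critical points
inside `[-1, 1]`. -/
theorem neg_one_le_criticalPoint_zero (h0 : 0 < p) (hp : p < π) : -1 ≤ criticalPoint p 0 := by
  have hE := criticalPoint_den_pos h0 hp (θ := 0) ⟨le_rfl, pi_pos.le⟩
  rw [criticalPoint, le_div_iff₀ hE]
  simp only [cos_zero, sin_zero, mul_zero, mul_one, sinc_zero]
  have h1 := add_one_le_exp p
  have h2 : exp p * exp (-p) = 1 := by rw [← exp_add]; simp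
  have h3 := exp_pos (-p)
  have h4 := cosh_sub_sinh p
  nlinarith [mul_le_mul_of_nonneg_right h1 h3.le]

/-! ### The extremal pieces of the distance function -/

theorem one_lt_sinh_div (h0 : 0 < p) : 1 < sinh p / (cosh p - 1) := by
  rw [one_lt_div (sub_pos.2 (one_lt_cosh.2 h0.ne'))]
  have := cosh_sub_sinh p
  have : exp (-p) < 1 := exp_lt_one_iff.2 (neg_neg_of_pos h0)
  linarith

theorem curveDistSq_zero (h0 : 0 < p) (τ : ℝ) :
    curveDistSq p τ 0 = (sinh p / (cosh p - 1) + τ) ^ 2 := by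
  have hc := sub_pos.2 (one_lt_cosh.2 h0.ne')
  simp only [curveDistSq, chordSq, cos_zero, sin_zero, mul_zero, mul_one]
  field_simp
  linear_combination cosh_sq p

theorem curveDistSq_pi (h0 : 0 < p) (τ : ℝ) :
    curveDistSq p τ π = (sinh p / (cosh p - 1) - τ) ^ 2 := by
  have hc := sub_pos.2 (one_lt_cosh.2 h0.ne')
  simp only [curveDistSq, chordSq, cos_pi, sin_pi, mul_zero, cos_zero, mul_neg, mul_one, cosh_neg,
    sinh_neg]
  field_simp
  linear_combination cosh_sq p

theorem curveDist_of_le (h0 : 0 < p) (hp : p < π) {τ : ℝ} (h1 : -1 ≤ τ)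
    (h2 : τ ≤ criticalPoint p 0) : curveDist p τ = sinh p / (cosh p - 1) + τ := by
  have hm := (strictMonoOn_criticalPoint h0 hp).monotoneOn
  rw [curveDist_eq h0 hp ⟨le_rfl, pi_pos.le⟩ (by simp)
    (fun θ hθ => h2.trans (hm ⟨le_rfl, pi_pos.le⟩ (Ioo_subset_Icc_self hθ) hθ.1.le)),
    curveDistSq_zero h0, Real.sqrt_sq]
  linarith [one_lt_sinh_div h0]

theorem curveDist_of_ge (h0 : 0 < p) (hp : p < π) {τ : ℝ} (h1 : τ ≤ 1)
    (h2 : criticalPoint p π ≤ τ) : curveDist p τ = sinh p / (cosh p - 1) - τ := by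
  have hm := (strictMonoOn_criticalPoint h0 hp).monotoneOn
  rw [curveDist_eq h0 hp ⟨pi_pos.le, le_rfl⟩
    (fun θ hθ => (hm (Ioo_subset_Icc_self hθ) ⟨pi_pos.le, le_rfl⟩ hθ.2.le).trans h2) (by simp),
    curveDistSq_pi h0, Real.sqrt_sq]
  linarith [one_lt_sinh_div h0]

theorem curveDist_pos (h0 : 0 < p) (hp : p < π) {τ : ℝ} (hτ : τ ∈ Icc (-1) 1) :
    0 < curveDist p τ := by
  have hk := one_lt_sinh_div h0
  rcases le_or_gt τ (criticalPoint p 0) with h1 | h1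
  · rw [curveDist_of_le h0 hp hτ.1 h1]; linarith [hτ.1]
  rcases le_or_gt (criticalPoint p π) τ with h2 | h2
  · rw [curveDist_of_ge h0 hp hτ.2 h2]; linarith [hτ.2]
  obtain ⟨θ, hθ, rfl⟩ := (criticalPoint_image h0 hp).ge ⟨h1, h2⟩
  exact curveDist_criticalPoint_pos h0 hp hθ

theorem continuousOn_inv_curveDist (h0 : 0 < p) (hp : p < π) :
    ContinuousOn (fun τ => (curveDist p τ)⁻¹) (Icc (-1) 1) :=
  (continuous_curveDist p).continuousOn.inv₀ fun _ hτ => (curveDist_pos h0 hp hτ).ne'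

theorem intervalIntegrable_inv_curveDist (h0 : 0 < p) (hp : p < π) {a b : ℝ}
    (ha : a ∈ Icc (-1 : ℝ) 1) (hb : b ∈ Icc (-1 : ℝ) 1) :
    IntervalIntegrable (fun τ => (curveDist p τ)⁻¹) MeasureTheory.volume a b :=
  ((continuousOn_inv_curveDist h0 hp).mono
    (ordConnected_Icc.uIcc_subset ha hb)).intervalIntegrable

theorem criticalPoint_zero_mem (h0 : 0 < p) (hp : p < π) : criticalPoint p 0 ∈ Icc (-1 : ℝ) 1 :=
  ⟨neg_one_le_criticalPoint_zero h0 hp, by linarith [criticalPoint_zero_lt h0 hp]⟩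

theorem criticalPoint_pi_mem (h0 : 0 < p) (hp : p < π) : criticalPoint p π ∈ Icc (-1 : ℝ) 1 := by
  have := criticalPoint_zero_mem h0 hp
  rw [criticalPoint_pi]
  exact ⟨by linarith [this.2], by linarith [this.1]⟩

/-! ### Integrals -/

/-- Integrability of `HH` comes for free: the inverse distance is continuous on a compact interval,
and monotone substitution transports its integrability. -/
theorem criticalPoint_changeOfVariables (h0 : 0 < p) (hp : p < π) :
    MeasureTheory.IntegrableOn (HH p) (Ioo 0 π) ∧
      ∫ τ in criticalPoint p 0..criticalPoint p π, (curveDist p τ)⁻¹ = ∫ θ in 0..π, HH p θ := by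
  have hm := strictMonoOn_criticalPoint h0 hp
  have hinj : InjOn (criticalPoint p) (Ioo 0 π) := hm.injOn.mono Ioo_subset_Icc_self
  have hd := fun θ (hθ : θ ∈ Ioo 0 π) =>
    (hasDerivAt_criticalPoint h0 hp hθ).hasDerivWithinAt (s := Ioo 0 π)
  have hle : criticalPoint p 0 ≤ criticalPoint p π :=
    hm.monotoneOn ⟨le_rfl, pi_pos.le⟩ ⟨pi_pos.le, le_rfl⟩ pi_pos.le
  have hcongr : EqOn (fun θ => |p ^ 2 * chordSq p θ * (sin (p * sin θ)
      - p * sin θ * cos (p * sin θ)) / criticalDen p θ ^ 2| • (curveDist p (criticalPoint p θ))⁻¹)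
      (HH p) (Ioo 0 π) := fun θ hθ => by
    simp only [smul_eq_mul]
    rw [HH_eq h0 hp hθ, abs_of_pos (deriv_criticalPoint_pos h0 hp hθ)]
  have hint := intervalIntegrable_inv_curveDist h0 hp (criticalPoint_zero_mem h0 hp)
    (criticalPoint_pi_mem h0 hp)
  rw [intervalIntegrable_iff_integrableOn_Ioo_of_le hle, ← criticalPoint_image h0 hp,
    MeasureTheory.integrableOn_image_iff_integrableOn_abs_deriv_smul measurableSet_Ioo hd hinj,
    MeasureTheory.integrableOn_congr_fun hcongr measurableSet_Ioo] at hint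
  refine ⟨hint, ?_⟩
  rw [intervalIntegral.integral_of_le hle, intervalIntegral.integral_of_le pi_pos.le,
    MeasureTheory.integral_Ioc_eq_integral_Ioo, MeasureTheory.integral_Ioc_eq_integral_Ioo,
    ← criticalPoint_image h0 hp,
    MeasureTheory.integral_image_eq_integral_abs_deriv_smul measurableSet_Ioo hd hinj]
  exact MeasureTheory.setIntegral_congr_fun measurableSet_Ioo hcongr

theorem intervalIntegrable_HH (h0 : 0 < p) (hp : p < π) :
    IntervalIntegrable (HH p) MeasureTheory.volume 0 π :=
  (intervalIntegrable_iff_integrableOn_Ioo_of_le pi_pos.le).2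
    (criticalPoint_changeOfVariables h0 hp).1

theorem HlogArg_pos (h0 : 0 < p) : 0 < HlogArg p := by
  have h := sinh_lt_mul_cosh (half_pos h0)
  have h1 := mul_pos (half_pos h0) (cosh_pos (p / 2))
  have : HlogArg p = 2 / p * (p * cosh (p / 2) - sinh (p / 2)) := by
    rw [HlogArg]; field_simp
  rw [this]
  exact mul_pos (by positivity) (by linarith)

theorem HlogArg_lt (h0 : 0 < p) : HlogArg p < exp (p / 2) := by
  have h1 : 1 < 2 / p * sinh (p / 2) := by
    have := self_lt_sinh_iff.2 (half_pos h0)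
    rw [div_mul_eq_mul_div, one_lt_div h0]
    linarith
  have h2 : exp (-(p / 2)) < 1 := exp_lt_one_iff.2 (by linarith)
  rw [HlogArg, ← cosh_add_sinh]
  rw [← cosh_sub_sinh] at h2
  linarith

theorem integral_inv_curveDist_left (h0 : 0 < p) (hp : p < π) :
    ∫ τ in (-1)..criticalPoint p 0, (curveDist p τ)⁻¹ = p / 2 - log (HlogArg p) := by
  have hT := neg_one_le_criticalPoint_zero h0 hp
  have hk := one_lt_sinh_div h0
  have h1 : ∫ τ in (-1)..criticalPoint p 0, (curveDist p τ)⁻¹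
      = ∫ τ in (-1)..criticalPoint p 0, (sinh p / (cosh p - 1) + τ)⁻¹ := by
    refine intervalIntegral.integral_congr fun τ hτ => ?_
    rw [uIcc_of_le hT] at hτ
    rw [curveDist_of_le h0 hp hτ.1 hτ.2]
  -- With `coth(p/2) = sinh p / (cosh p - 1)` this is an elementary logarithm; what follows
  -- simplifies its argument by half-angle formulas.
  rw [h1, intervalIntegral.integral_comp_add_left (fun x => x⁻¹),
    integral_inv_of_pos (by linarith) (by linarith)]
  have h2 : p / 2 - log (HlogArg p) = log (exp (p / 2) / HlogArg p) := by
    rw [log_div (exp_pos _).ne' (HlogArg_pos h0).ne', log_exp]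
  rw [h2]
  congr 1
  have hb : 0 < sinh (p / 2) := sinh_pos_iff.2 (half_pos h0)
  have hsq := cosh_sq (p / 2)
  have e1 : cosh p = 1 + 2 * sinh (p / 2) ^ 2 := by
    have := cosh_two_mul (p / 2)
    rw [mul_div_cancel₀ p two_ne_zero] at this
    rw [this, cosh_sq]; ring
  have e2 : sinh p = 2 * sinh (p / 2) * cosh (p / 2) := by
    rw [← sinh_two_mul, mul_div_cancel₀ p two_ne_zero]
  have hab : 0 < cosh (p / 2) - sinh (p / 2) := by rw [cosh_sub_sinh]; exact exp_pos _
  have hpab : 0 < p * cosh (p / 2) - sinh (p / 2) := by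
    have h := sinh_lt_mul_cosh (half_pos h0)
    have h1 := mul_pos (half_pos h0) (cosh_pos (p / 2))
    linarith
  have hL : HlogArg p = 2 * (p * cosh (p / 2) - sinh (p / 2)) / p := by
    rw [HlogArg]; field_simp
  rw [hL, ← cosh_add_sinh, criticalPoint]
  simp only [cos_zero, sin_zero, mul_zero, mul_one, sinc_zero, one_mul]
  rw [e1, e2]
  generalize cosh (p / 2) = a at *
  generalize sinh (p / 2) = b at *
  have e3 : 1 - (1 + 2 * b ^ 2) + p * (2 * b * a) = 2 * b * (p * a - b) := by ring
  have e4 : 2 * b * a / (1 + 2 * b ^ 2 - 1) = a / b := by field_simp; ring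
  rw [e3, e4]
  have e5 : a / b + -1 = (a - b) / b := by field_simp; ring
  rw [e5]
  have hne : a * p - b ≠ 0 := by rw [mul_comm]; exact hpab.ne'
  field_simp
  linear_combination p * hsq

/-- The reflection `τ ↦ -τ` exchanges the two outer ranges. -/
theorem integral_inv_curveDist_right (h0 : 0 < p) (hp : p < π) :
    ∫ τ in criticalPoint p π..1, (curveDist p τ)⁻¹
      = ∫ τ in (-1)..criticalPoint p 0, (curveDist p τ)⁻¹ := by
  rw [← neg_neg (criticalPoint p 0), ← criticalPoint_pi,
    ← intervalIntegral.integral_comp_neg (fun τ => (curveDist p τ)⁻¹)]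
  have hT := (criticalPoint_pi_mem h0 hp).2
  refine intervalIntegral.integral_congr fun τ hτ => ?_
  rw [uIcc_of_le hT] at hτ
  have := hτ.1
  rw [criticalPoint_pi] at this
  rw [curveDist_of_ge h0 hp hτ.2 hτ.1, curveDist_of_le h0 hp (by linarith [hτ.2]) (by linarith)]
  ring

theorem integral_inv_curveDist (h0 : 0 < p) (hp : p < π) :
    ∫ τ in (-1)..1, (curveDist p τ)⁻¹ = H p := by
  have hi := fun {a b : ℝ} => intervalIntegrable_inv_curveDist h0 hp (a := a) (b := b)
  have m0 : (-1 : ℝ) ∈ Icc (-1 : ℝ) 1 := by simp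
  have m1 : (1 : ℝ) ∈ Icc (-1 : ℝ) 1 := by simp
  have hT := criticalPoint_zero_mem h0 hp
  have hS := criticalPoint_pi_mem h0 hp
  rw [← intervalIntegral.integral_add_adjacent_intervals (hi m0 hT) (hi hT m1),
    ← intervalIntegral.integral_add_adjacent_intervals (hi hT hS) (hi hS m1),
    integral_inv_curveDist_right h0 hp, integral_inv_curveDist_left h0 hp,
    (criticalPoint_changeOfVariables h0 hp).2, H]
  ring

theorem H_pos (h0 : 0 < p) (hp : p < π) : 0 < H p := by
  have h1 : log (HlogArg p) < p / 2 := (log_lt_iff_lt_exp (HlogArg_pos h0)).2 (HlogArg_lt h0)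
  have h2 : 0 < ∫ t in (0 : ℝ)..π, HH p t :=
    intervalIntegral.intervalIntegral_pos_of_pos_on (intervalIntegrable_HH h0 hp)
      (fun _ => HH_pos h0 hp) pi_pos
  rw [H]
  linarith

/-! ### The maximum principle -/

theorem segment_exp_ne_zero (hp : p < π) {t : ℝ} (ht : t ∈ Icc (0 : ℝ) 1) {w : ℂ}
    (hw : w ∈ Metric.closedBall (0 : ℂ) p) : (1 - t + t * Complex.exp w : ℂ) ≠ 0 := by
  intro h
  have hre := congrArg Complex.re h
  have him := congrArg Complex.im h
  simp only [Complex.add_re, Complex.add_im, Complex.sub_re, Complex.sub_im, Complex.one_re,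
    Complex.one_im, Complex.ofReal_re, Complex.ofReal_im, Complex.re_ofReal_mul,
    Complex.im_ofReal_mul, Complex.exp_re, Complex.exp_im, Complex.zero_re, Complex.zero_im,
    sub_zero, zero_add] at hre him
  have hv : |w.im| < π := by
    have := Complex.abs_im_le_norm w
    rw [mem_closedBall_zero_iff] at hw
    linarith
  have he := exp_pos w.re
  have ht0 : t ≠ 0 := by rintro rfl; simp at hre
  have hs : sin w.im = 0 := by
    simpa [ht0, he.ne'] using him
  have hw0 := (sin_eq_zero_iff_of_lt_of_lt (abs_lt.1 hv).1 (abs_lt.1 hv).2).1 hs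
  rw [hw0, cos_zero, mul_one] at hre
  have := mul_pos (lt_of_le_of_ne ht.1 ht0.symm) he
  linarith [ht.2]

theorem norm_exp_sub_one_mul_curveDist_le_of_mem_sphere (h0 : 0 < p) (hp : p < π) (t : ℝ) {w : ℂ}
    (hw : ‖w‖ = p) :
    ‖Complex.exp w - 1‖ * curveDist p (2 * t - 1) ≤ 2 * ‖(1 - t + t * Complex.exp w : ℂ)‖ := by
  obtain ⟨θ, hθ, hu, hv⟩ : ∃ θ ∈ Icc 0 π, p * cos θ = w.re ∧ p * sin θ = |w.im| := by
    -- Conjugating `w` changes neither side, so the upper half of the circle suffices.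
    refine ⟨|w.arg|, ⟨abs_nonneg _, Complex.abs_arg_le_pi w⟩, ?_, ?_⟩
    · rw [cos_abs, ← hw, Complex.norm_mul_cos_arg]
    · rw [← abs_sin_eq_sin_abs_of_abs_le_pi (Complex.abs_arg_le_pi w), ← abs_of_pos h0, ← abs_mul,
        ← hw, Complex.norm_mul_sin_arg]
  have hle : curveDist p (2 * t - 1) ≤ dist ((2 * t - 1 : ℝ) : ℂ) (cothCurve p θ) :=
    Metric.infDist_le_dist_of_mem (mem_image_of_mem _ hθ)
  refine (mul_le_mul_of_nonneg_left hle (norm_nonneg _)).trans_eq ?_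
  refine (sq_eq_sq₀ (by positivity) (by positivity)).1 ?_
  rw [mul_pow, mul_pow, dist_cothCurve_sq h0 hp, Complex.sq_norm, Complex.sq_norm,
    Complex.normSq_apply, Complex.normSq_apply]
  simp only [Complex.add_re, Complex.add_im, Complex.sub_re, Complex.sub_im, Complex.one_re,
    Complex.one_im, Complex.ofReal_re, Complex.ofReal_im, Complex.re_ofReal_mul,
    Complex.im_ofReal_mul, Complex.exp_re, Complex.exp_im, sub_zero, zero_add]
  have hQ := (chordSq_pos h0 hp θ).ne'
  rw [chordSq, hu, hv, cos_abs] at hQ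
  rw [curveDistSq, chordSq, hu, hv, cos_abs, ← cosh_add_sinh]
  have h1 := sin_sq_add_cos_sq w.im
  have h2 := cosh_sq w.re
  generalize cosh w.re = a at *
  generalize sinh w.re = b at *
  generalize cos w.im = c at *
  generalize sin w.im = s at *
  -- `|e^w - 1|² = 2 e^u (cosh u - cos v)`; `e2` extracts the same factor `e^u` from the right-hand
  -- side.
  have e1 : ((a + b) * c - 1) * ((a + b) * c - 1) + (a + b) * s * ((a + b) * s)
      = 2 * (a + b) * (a - c) := by
    linear_combination (a + b) ^ 2 * h1 - h2
  have e2 : (1 - t + t * ((a + b) * c)) * (1 - t + t * ((a + b) * c))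
      + t * ((a + b) * s) * (t * ((a + b) * s))
      = (a + b) * ((1 - t) ^ 2 * (a - b) + t ^ 2 * (a + b) + 2 * t * (1 - t) * c) := by
    linear_combination t ^ 2 * (a + b) ^ 2 * h1 - (1 - t) ^ 2 * h2
  rw [e1, e2]
  field_simp
  ring

theorem norm_exp_sub_one_mul_curveDist_le (h0 : 0 < p) (hp : p < π) {t : ℝ}
    (ht : t ∈ Icc (0 : ℝ) 1) {w : ℂ} (hw : w ∈ Metric.closedBall (0 : ℂ) p) :
    ‖Complex.exp w - 1‖ * curveDist p (2 * t - 1) ≤ 2 * ‖(1 - t + t * Complex.exp w : ℂ)‖ := by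
  have hρ : 0 < curveDist p (2 * t - 1) :=
    curveDist_pos h0 hp ⟨by linarith [ht.1], by linarith [ht.2]⟩
  have hcl : closure (Metric.ball (0 : ℂ) p) = Metric.closedBall 0 p := closure_ball _ h0.ne'
  have hne : ∀ z ∈ Metric.closedBall (0 : ℂ) p, (1 - t + t * Complex.exp z : ℂ) ≠ 0 :=
    fun z hz => segment_exp_ne_zero hp ht hz
  have hd : DiffContOnCl ℂ (fun z : ℂ => (Complex.exp z - 1) / (1 - t + t * Complex.exp z))
      (Metric.ball 0 p) := by
    refine DifferentiableOn.diffContOnCl ?_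
    rw [hcl]
    exact DifferentiableOn.div (by fun_prop) (by fun_prop) hne
  have hmax := Complex.norm_le_of_forall_mem_frontier_norm_le Metric.isBounded_ball hd
    (C := 2 / curveDist p (2 * t - 1)) (fun z hz => by
      rw [frontier_ball _ h0.ne', mem_sphere_zero_iff_norm] at hz
      have hz' : z ∈ Metric.closedBall (0 : ℂ) p := mem_closedBall_zero_iff.2 hz.le
      rw [norm_div, div_le_div_iff₀ (norm_pos_iff.2 (hne z hz')) hρ]
      exact norm_exp_sub_one_mul_curveDist_le_of_mem_sphere h0 hp t hz)
    (hcl ▸ hw)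
  rwa [norm_div, div_le_div_iff₀ (norm_pos_iff.2 (hne w hw)) hρ] at hmax

theorem exists_pos_le_norm_segment_exp (h0 : 0 < p) (hp : p < π) :
    ∃ c > 0, ∀ t ∈ Icc (0 : ℝ) 1, ∀ w ∈ Metric.closedBall (0 : ℂ) p,
      c ≤ ‖(1 - t + t * Complex.exp w : ℂ)‖ := by
  obtain ⟨⟨s, v⟩, ⟨hs, hv⟩, hmin⟩ :=
    ((isCompact_Icc (a := (0 : ℝ)) (b := 1)).prod (isCompact_closedBall (0 : ℂ) p)).exists_isMinOn
      (f := fun q : ℝ × ℂ => ‖(1 - q.1 + q.1 * Complex.exp q.2 : ℂ)‖)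
      ⟨(0, 0), by simp, by simpa using h0.le⟩ (by fun_prop)
  exact ⟨_, norm_pos_iff.2 (segment_exp_ne_zero hp hs hv), fun t ht w hw => @hmin (t, w) ⟨ht, hw⟩⟩

/-! ### The logarithm of an operator with conformal range in `exp D̄(0,p)` -/

variable {𝕜 E : Type*} [RCLike 𝕜] [NormedAddCommGroup E] [InnerProductSpace 𝕜 E] [CompleteSpace E]

theorem isLogable_of_conformalRange_subset (h0 : 0 < p) (hp : p < π) (A : E →L[𝕜] E)
    (hA : conformalRange A ⊆ Complex.exp '' Metric.closedBall 0 p) : IsLogable A := by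
  obtain ⟨c, hc, h⟩ := exists_pos_le_norm_segment_exp h0 hp
  refine isLogable_of_bounded_below A hc fun t ht x => ?_
  rcases eq_or_ne x 0 with rfl | hx
  · simp
  obtain ⟨w, hw, hwx⟩ := hA (ratio_mem_conformalRange A hx)
  rw [norm_segmentPoint_apply A t hx, ← hwx]
  exact mul_le_mul_of_nonneg_right (h t ht w hw) (norm_nonneg x)

theorem norm_opLog_le_of_conformalRange_subset (h0 : 0 < p) (hp : p < π) (A : E →L[𝕜] E)
    (hA : conformalRange A ⊆ Complex.exp '' Metric.closedBall 0 p) : ‖opLog A‖ ≤ H p := by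
  have hmem : ∀ t ∈ Icc (0 : ℝ) 1, 2 * t - 1 ∈ Icc (-1 : ℝ) 1 := fun t ht =>
    ⟨by linarith [ht.1], by linarith [ht.2]⟩
  have hint : IntervalIntegrable (fun t => 2 * (curveDist p (2 * t - 1))⁻¹)
      MeasureTheory.volume 0 1 := by
    refine ContinuousOn.intervalIntegrable ?_
    rw [uIcc_of_le zero_le_one]
    exact continuousOn_const.mul
      ((continuousOn_inv_curveDist h0 hp).comp (f := fun t => 2 * t - 1) (by fun_prop) hmem)
  -- The factor 2 is the Jacobian of `τ = 2t - 1`.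
  have hH : ∫ t in (0 : ℝ)..1, 2 * (curveDist p (2 * t - 1))⁻¹ = H p := by
    rw [intervalIntegral.integral_const_mul, ← smul_eq_mul,
      intervalIntegral.smul_integral_comp_mul_sub (fun τ => (curveDist p τ)⁻¹),
      ← integral_inv_curveDist h0 hp]
    norm_num
  rw [← hH]
  refine norm_opLog_le A (isLogable_of_conformalRange_subset h0 hp A hA) hint
    (fun t ht => ?_) fun t ht x => ?_
  · have := curveDist_pos h0 hp (hmem t ht)
    positivity
  · have hρ := curveDist_pos h0 hp (hmem t ht)
    rcases eq_or_ne x 0 with rfl | hx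
    · simp
    obtain ⟨w, hw, hwx⟩ := hA (ratio_mem_conformalRange A hx)
    rw [norm_segmentPoint_apply A t hx, norm_sub_one_apply A hx, ← hwx, ← mul_assoc]
    refine mul_le_mul_of_nonneg_right ?_ (norm_nonneg x)
    rw [mul_right_comm, ← div_eq_mul_inv, le_div_iff₀ hρ]
    exact norm_exp_sub_one_mul_curveDist_le h0 hp ht hw

end

end ConformalRange

/-- For a bounded operator `A` on a real or complex Hilbert space whose conformal range lies in
`exp D̄(0,p)`, `0 < p < π`, the logarithm exists and `‖log A‖ ≤ H(p)`; the same for `p = 0` with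
`0` as the bound; and `H(p)`, `HH(p,t)` are well defined (no vanishing denominator, convergent
integral) and positive for `0 < p < π`, `0 < t < π`. -/
theorem mainTheorem2 {𝕜 E : Type*} [RCLike 𝕜] [NormedAddCommGroup E]
    [InnerProductSpace 𝕜 E] [CompleteSpace E] :
    (∀ p : ℝ, 0 < p → p < Real.pi → ∀ A : E →L[𝕜] E,
      ConformalRange.conformalRange A ⊆ Complex.exp '' Metric.closedBall 0 p →
        ConformalRange.IsLogable A ∧ ‖ConformalRange.opLog A‖ ≤ ConformalRange.H p) ∧
    (∀ A : E →L[𝕜] E,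
      ConformalRange.conformalRange A ⊆ Complex.exp '' Metric.closedBall 0 0 →
        ConformalRange.IsLogable A ∧ ‖ConformalRange.opLog A‖ ≤ 0) ∧
    (∀ p : ℝ, 0 < p → p < Real.pi →
      (∀ t ∈ Set.Ioo 0 Real.pi,
        ConformalRange.HHden p t ≠ 0 ∧ 0 < ConformalRange.HH p t) ∧
      IntervalIntegrable (ConformalRange.HH p) MeasureTheory.volume 0 Real.pi ∧
      0 < ConformalRange.HlogArg p ∧
      0 < ConformalRange.H p) := by
  refine ⟨fun p h0 hp A hA => ⟨ConformalRange.isLogable_of_conformalRange_subset h0 hp A hA,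
    ConformalRange.norm_opLog_le_of_conformalRange_subset h0 hp A hA⟩, fun A hA => ?_,
    fun p h0 hp => ⟨fun t ht => ⟨(ConformalRange.HHden_pos h0 hp ht).ne',
      ConformalRange.HH_pos h0 hp ht⟩, ConformalRange.intervalIntegrable_HH h0 hp,
      ConformalRange.HlogArg_pos h0, ConformalRange.H_pos h0 hp⟩⟩
  -- The disc of radius 0 has exponential image `{1}`, which forces `A = Id`.
  obtain rfl := ConformalRange.eq_one_of_conformalRange_subset A (by simpa using hA)
  exact ⟨ConformalRange.isLogable_one, by rw [ConformalRange.opLog_one, norm_zero]⟩
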